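/- Let $A,B\in\mathbb{Z}$ with $4A^3+27B^2\neq 0$, let $E: y^2=x^3+Ax+B$, and for a squarefree positive integer $D$ let $$E_D:\ y^2=x^3+D^2Ax+D^3B$$ be the quadratic twist of $E$ by $D$. Let $M$ be a positive integer with $\max\{10\sqrt{|A|},\,5\sqrt[3]{|B|}\}\le M$. Let $h$ be the absolute logarithmic height on $\overline{\mathbb{Q}}$; for $P\in E_D(\overline{\mathbb{Q}})$ put $h(P)=h(x(P))$, with $h(O)=0$. Let $E_D(\mathbb{Z})$ be the set of affine points of $E_D$ with integer coordinates. Fix an embedding $\overline{\mathbb{Q}}\hookrightarrow\mathbb{C}$, and let $|\cdot|$ be the induced absolute value on $\overline{\mathbb{Q}}$. There is a constant $D_0$, depending only on $E$ (that is, on $A$ and $B$), such that the following holds for every squarefree integer $D\ge D_0$. Let $P\in E_D(\mathbb{Z})$ and let $P=3Q+R$ with $Q,R\in E_D(\mathbb{Q})$, where $R\neq O$. Assume that $$x(R)\ge MD,\qquad h(P)>1000\,h(R),\qquad h(P)>2000\log D .$$ Let $S$ be a point of $\tfrac13R=\{T\in E_D(\overline{\mathbb{Q}}) : 3T=R\}$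 for which $|x(Q)-x(S)|$ is minimal among the points of $\tfrac13 R$ (the hypotheses force $Q\ne O$, and $O\notin\tfrac13R$, so these $x$-coordinates exist). Then $$h(Q)>5.77\,h(S)$$ and $x(Q)\ne x(S)$, with $$\frac{\log|x(Q)-x(S)|}{h(Q)}<-2.75 .$$ -/

import Mathlib

open scoped WeierstrassCurve.Affine

noncomputable section

namespace QuadraticTwist

/-- The field of algebraic numbers. -/
abbrev Qbar : Type := AlgebraicClosure ℚ

/-- The quadratic twist `E_D : y² = x³ + D²A x + D³B` of `E : y² = x³ + A x + B`. -/
def twist (A B : ℤ) (D : ℕ) : WeierstrassCurve.Affine ℤ where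
  a₁ := 0
  a₂ := 0
  a₃ := 0
  a₄ := (D : ℤ) ^ 2 * A
  a₆ := (D : ℤ) ^ 3 * B

/-- The group `E_D(F)`: the affine solutions in `F` together with the point at infinity. -/
abbrev Pt (A B : ℤ) (D : ℕ) (F : Type) [Field F] : Type :=
  ((twist A B D)⁄F).Point

variable {A B : ℤ} {D : ℕ}

/-- The `x`-coordinate of an affine point. The point at infinity has no `x`-coordinate;
the value `0` given to it here is a dummy. -/
def xCoord {F : Type} [Field F] : Pt A B D F → F
  | .zero => 0
  | .some x _ _ => x

/-- The absolute logarithmic Weil height `h(P) = h(x(P))`, with `h(O) = 0`. -/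
def height {F : Type} [Field F] [CharZero F] : Pt A B D F → ℝ
  | .zero => 0
  | .some x _ _ => NumberField.absLogHeight₁ x

/-- `P ∈ E_D(ℤ)`: an affine point both of whose coordinates are integers. -/
def IsIntegralPoint (P : Pt A B D ℚ) : Prop :=
  ∃ (x y : ℤ) (h : ((twist A B D)⁄ℚ).Nonsingular (x : ℚ) (y : ℚ)), P = .some (x : ℚ) (y : ℚ) h

open Classical in
/-- The set `(1/3)R` of all `T ∈ E_D(ℚ̄)` with `3T = R`. -/
def third (R : Pt A B D ℚ) : Set (Pt A B D Qbar) :=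
  {T | 3 • T = WeierstrassCurve.Affine.Point.baseChange (W' := twist A B D) ℚ Qbar R}

/-- The distance `|x(Q) - x(T)|` for `Q ∈ E_D(ℚ)` and `T ∈ E_D(ℚ̄)`, with respect to the
archimedean absolute value on `ℚ̄` given by the embedding `ι`. -/
def xDist (ι : Qbar →+* ℂ) (Q : Pt A B D ℚ) (T : Pt A B D Qbar) : ℝ :=
  ‖((xCoord Q : ℚ) : ℂ) - ι (xCoord T)‖

end QuadraticTwist

end

open scoped WeierstrassCurve.Affine

noncomputable section

namespace QuadraticTwist

section

open Height NumberField Polynomial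

/-! ### Heights in a number field: roots of integer polynomials and rational numbers -/

section NumberFieldHeights

variable {K : Type*} [Field K]

/-! Heights. Over ℚ(√D) the twist becomes isomorphic to E through x ↦ x/D, so the height of x/D
satisfies the parallelogram law with an error independent of D (`exists_parallelogram`), and it
differs from h by at most log D. Since 3Q = P - R, with h(R) and log D tiny against h(P), this traps
h(Q) roughly between h(P)/18 and h(P)/6. The tripling equation for x(S)/D gives h(S) ≤ h(R) + O(log
D) (`exists_height_third_le`), which is negligible (`height_estimates`).

Distance. As P is integral, |x(P)| = exp(h(P)), so P is close to O. The nine solutions of the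
tripling equation over x(P) sum to 9x(P), so some W with 3W = P has |x(W)| ≥ |x(P)|
(`exists_large_third`). Then T = W - Q is a third of R, and since W is close to O, T is close to -Q:
x(T) - x(Q) is of order |x(W)|^(-1/2) (`exists_close_third`). By minimality S is at least as close,
so |x(Q) - x(S)| ≤ exp(-0.488 h(P)); dividing the logarithm by h(Q), about h(P)/6 at most, gives a
ratio below -2.75.

The distance is not zero: x(Q) = x(S) would force 3Q = ±R, that is P = 2R or P = O
(`xDist_ne_zero`). -/

lemma leadingCoeff_mul_max_le_sum (v : AbsoluteValue K ℝ) {f : ℤ[X]} {α : K}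
    (h : aeval α f = 0) :
    v f.leadingCoeff * max (v α) 1 ≤ ∑ i ∈ Finset.range (f.natDegree + 1), v (f.coeff i) := by
  rcases le_total (v α) 1 with h1 | h1
  · rw [max_eq_right h1, mul_one]
    exact Finset.single_le_sum (f := fun i ↦ v (f.coeff i)) (fun i _ ↦ apply_nonneg v _)
      (Finset.self_mem_range_succ _)
  · rw [max_eq_left h1]
    rw [aeval_eq_sum_range, Finset.sum_range_succ] at h
    have h2 : (f.leadingCoeff : K) * α ^ f.natDegree =
        -∑ i ∈ Finset.range f.natDegree, (f.coeff i : K) * α ^ i := by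
      simp only [zsmul_eq_mul] at h
      rw [leadingCoeff]
      linear_combination h
    rcases Nat.eq_zero_or_pos f.natDegree with h0 | h0
    · rw [h0, Finset.range_zero, Finset.sum_empty, neg_zero, pow_zero, mul_one] at h2
      rw [h2, map_zero, zero_mul]
      exact Finset.sum_nonneg fun i _ ↦ apply_nonneg v _
    · have h3 : v f.leadingCoeff * v α ^ f.natDegree ≤
          (∑ i ∈ Finset.range f.natDegree, v (f.coeff i)) * v α ^ (f.natDegree - 1) := by
        rw [← map_pow, ← map_mul, h2, map_neg_eq_map, Finset.sum_mul]
        refine (v.sum_le _ _).trans (Finset.sum_le_sum fun i hi ↦ ?_)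
        rw [map_mul, map_pow]
        gcongr
        have := Finset.mem_range.mp hi; omega
      have hp : 0 < v α ^ (f.natDegree - 1) := by positivity
      have h4 : v α ^ f.natDegree = v α * v α ^ (f.natDegree - 1) := by
        rw [← pow_succ']; congr 1; omega
      rw [h4, ← mul_assoc] at h3
      rw [Finset.sum_range_succ]
      have := le_of_mul_le_mul_right h3 hp
      linarith [apply_nonneg v (f.coeff f.natDegree : K)]

lemma leadingCoeff_mul_max_le_one {v : AbsoluteValue K ℝ} (hv : IsNonarchimedean v) {f : ℤ[X]}
    {α : K} (hf : aeval α f = 0) :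
    v f.leadingCoeff * max (v α) 1 ≤ 1 := by
  have hi (n : ℤ) : v n ≤ 1 := hv.apply_intCast_le_one
  rcases le_total (v α) 1 with h1 | h1
  · rw [max_eq_right h1, mul_one]
    exact hi _
  · rw [max_eq_left h1]
    rw [aeval_eq_sum_range, Finset.sum_range_succ] at hf
    have h2 : (f.leadingCoeff : K) * α ^ f.natDegree =
        -∑ i ∈ Finset.range f.natDegree, (f.coeff i : K) * α ^ i := by
      simp only [zsmul_eq_mul] at hf
      rw [leadingCoeff]
      linear_combination hf
    have hsum : v (∑ i ∈ Finset.range f.natDegree, (f.coeff i : K) * α ^ i) * v α ≤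
        v α ^ f.natDegree := by
      rcases Nat.eq_zero_or_pos f.natDegree with h0 | h0
      · simp [h0]
      · obtain ⟨i, hi', hle⟩ := hv.finset_image_add_of_nonempty
          (fun i ↦ (f.coeff i : K) * α ^ i) (Finset.nonempty_range_iff.mpr h0.ne')
        refine (mul_le_mul_of_nonneg_right hle (by positivity)).trans ?_
        rw [map_mul, map_pow, mul_assoc, ← pow_succ]
        have := Finset.mem_range.mp hi'
        calc v (f.coeff i) * v α ^ (i + 1) ≤ 1 * v α ^ f.natDegree := by
              gcongr
              · exact hi _
              · omega
          _ = _ := one_mul _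
    rw [← map_neg_eq_map v, ← h2, map_mul, map_pow] at hsum
    have hp : 0 < v α ^ f.natDegree := by positivity
    refine le_of_mul_le_mul_right ?_ hp
    linarith

lemma infinitePlace_intCast (v : InfinitePlace K) (n : ℤ) : v (n : K) = |(n : ℝ)| := by
  rw [← InfinitePlace.norm_embedding_eq, map_intCast, Complex.norm_intCast]

/-- The length of an integer polynomial: the sum of the absolute values of its coefficients. -/
def length (f : ℤ[X]) : ℝ := ∑ i ∈ Finset.range (f.natDegree + 1), |(f.coeff i : ℝ)|

lemma length_nonneg (f : ℤ[X]) : 0 ≤ length f := Finset.sum_nonneg fun _ _ ↦ abs_nonneg _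

lemma length_pos {f : ℤ[X]} (hf : f ≠ 0) : 0 < length f := by
  refine Finset.sum_pos' (fun _ _ ↦ abs_nonneg _) ⟨_, Finset.self_mem_range_succ _, ?_⟩
  simpa using hf

lemma length_eq_sum {f : ℤ[X]} {n : ℕ} (hn : f.natDegree < n) :
    length f = ∑ i ∈ Finset.range n, |(f.coeff i : ℝ)| := by
  refine Finset.sum_subset (Finset.range_mono hn) fun i _ hi ↦ ?_
  rw [coeff_eq_zero_of_natDegree_lt (by simpa using hi)]
  simp

lemma length_C_mul_sub_C_mul_le (m n : ℤ) (f g : ℤ[X]) :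
    length (C m * f - C n * g) ≤ |(m : ℝ)| * length f + |(n : ℝ)| * length g := by
  set N := max f.natDegree g.natDegree + 1
  have hf : f.natDegree < N := Nat.lt_succ_of_le (le_max_left _ _)
  have hg : g.natDegree < N := Nat.lt_succ_of_le (le_max_right _ _)
  have hfg : (C m * f - C n * g).natDegree < N := by
    refine Nat.lt_succ_of_le ((natDegree_sub_le _ _).trans (max_le_max ?_ ?_)) <;>
    exact natDegree_C_mul_le _ _
  rw [length_eq_sum hf, length_eq_sum hg, length_eq_sum hfg, Finset.mul_sum, Finset.mul_sum,
    ← Finset.sum_add_distrib]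
  refine Finset.sum_le_sum fun i _ ↦ ?_
  rw [coeff_sub, coeff_C_mul, coeff_C_mul, ← abs_mul, ← abs_mul]
  push_cast
  exact abs_sub _ _

variable [NumberField K]

/-- Multiply the local bounds over all places: by the product formula the leading coefficient
contributes 1 in total. -/
lemma mulHeight₁_le_length_pow {f : ℤ[X]} (hf : f ≠ 0) {α : K} (h : aeval α f = 0) :
    mulHeight₁ α ≤ length f ^ Module.finrank ℚ K := by
  have hd : (f.leadingCoeff : K) ≠ 0 := by simpa using hf
  have hpf := prod_abs_eq_one hd
  have hsd := FinitePlace.hasFiniteMulSupport hd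
  have hsα : (fun v : FinitePlace K ↦ max (v α) 1).HasFiniteMulSupport := by
    rcases eq_or_ne α 0 with rfl | hα
    · simp [Function.HasFiniteMulSupport, Function.mulSupport]
    · have := FinitePlace.hasFiniteMulSupport hα
      fun_prop
  have hfin : (∏ᶠ v : FinitePlace K, v (f.leadingCoeff : K)) * ∏ᶠ v : FinitePlace K, max (v α) 1
      ≤ 1 := by
    rw [← finprod_mul_distrib hsd hsα]
    refine (finprod_le_finprod (hsd.mul hsα) (fun v ↦
      mul_nonneg (apply_nonneg v _) (by positivity)) (g := fun _ ↦ 1)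
      (by fun_prop) fun v ↦ ?_).trans (finprod_one).le
    exact leadingCoeff_mul_max_le_one (v := v.val) (FinitePlace.add_le v) h
  have hinf : (∏ v : InfinitePlace K, v (f.leadingCoeff : K) ^ v.mult) *
      ∏ v : InfinitePlace K, max (v α) 1 ^ v.mult ≤ length f ^ Module.finrank ℚ K := by
    rw [← InfinitePlace.sum_mult_eq, ← Finset.prod_pow_eq_pow_sum, ← Finset.prod_mul_distrib]
    refine Finset.prod_le_prod (fun v _ ↦ by positivity) fun v _ ↦ ?_
    rw [← mul_pow]
    gcongr
    refine (leadingCoeff_mul_max_le_sum v.val h).trans (le_of_eq ?_)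
    exact Finset.sum_congr rfl fun i _ ↦ infinitePlace_intCast v _
  rw [NumberField.mulHeight₁_eq]
  calc _ = ((∏ v : InfinitePlace K, v (f.leadingCoeff : K) ^ v.mult) *
      ∏ v : InfinitePlace K, max (v α) 1 ^ v.mult) *
      ((∏ᶠ v : FinitePlace K, v (f.leadingCoeff : K)) * ∏ᶠ v : FinitePlace K, max (v α) 1) := by
        rw [mul_mul_mul_comm, hpf, one_mul]
    _ ≤ length f ^ Module.finrank ℚ K * 1 := by
        gcongr
        · exact mul_nonneg (finprod_nonneg fun v ↦ apply_nonneg v _)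
            (finprod_nonneg fun v ↦ by positivity)
        · exact pow_nonneg (length_nonneg f) _
    _ = _ := mul_one _

/-- A Bézout relation between numerator and denominator makes every finite place contribute 1. -/
lemma mulHeight₁_ratCast (q : ℚ) :
    mulHeight₁ (q : K) = (max q.num.natAbs q.den : ℝ) ^ Module.finrank ℚ K := by
  have hd : (q.den : K) ≠ 0 := by exact_mod_cast q.den_nz
  have h0 : ![(q.num : K), q.den] ≠ 0 := fun h ↦ hd (by simpa using congrFun h 1)
  have hmax (v : K → ℝ) : ⨆ i, v (![(q.num : K), q.den] i) = max (v q.num) (v q.den) := by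
    refine le_antisymm (ciSup_le fun i ↦ ?_) (max_le ?_ ?_)
    · fin_cases i <;> simp
    · exact Finite.le_ciSup_of_le 0 <| by simp
    · exact Finite.le_ciSup_of_le 1 <| by simp
  have hfin (v : FinitePlace K) : ⨆ i, v (![(q.num : K), q.den] i) = 1 := by
    have hv : IsNonarchimedean (v ·) := FinitePlace.add_le v
    have H (n : ℤ) : v n ≤ 1 := IsNonarchimedean.apply_intCast_le_one hv
    have Hd : v (q.den : K) ≤ 1 := by exact_mod_cast H q.den
    rw [hmax]
    refine le_antisymm (max_le (H _) Hd) ?_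
    obtain ⟨a, b, hab⟩ := Rat.isCoprime_num_den q
    have hab' : (a : K) * q.num + b * q.den = 1 := by exact_mod_cast congrArg (Int.cast (R := K)) hab
    have h1 : (1 : ℝ) ≤ max (v (a * q.num)) (v (b * q.den)) := by
      rw [← map_one v, ← hab']
      exact hv _ _
    refine h1.trans (max_le_max ?_ ?_) <;> rw [map_mul]
    · exact mul_le_of_le_one_left (apply_nonneg v _) (H _)
    · exact mul_le_of_le_one_left (apply_nonneg v _) (H _)
  rw [Rat.cast_def, mulHeight₁_div_eq_mulHeight, NumberField.mulHeight_eq h0,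
    finprod_eq_one_of_forall_eq_one hfin, mul_one, ← InfinitePlace.sum_mult_eq,
    ← Finset.prod_pow_eq_pow_sum]
  refine Finset.prod_congr rfl fun v _ ↦ ?_
  have h1 := infinitePlace_intCast v q.num
  have h2 := infinitePlace_intCast v q.den
  rw [hmax, h1]
  push_cast at h2 ⊢
  rw [h2, Nat.abs_cast]
  simp

end NumberFieldHeights

/-! ### Passage to the absolute height -/

section AbsoluteHeights

open scoped IntermediateField

variable {F : Type*} [Field F] [CharZero F]

lemma absLogHeight₁_le_of_mulHeight₁_le {x : F} (hx : IsIntegral ℚ x) {c : ℝ} (hc : 0 < c)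
    (h : ∀ (K : IntermediateField ℚ F) [NumberField K] (y : K), (y : F) = x →
      mulHeight₁ y ≤ c ^ Module.finrank ℚ K) :
    absLogHeight₁ x ≤ Real.log c := by
  have : FiniteDimensional ℚ ℚ⟮x⟯ := IntermediateField.adjoin.finiteDimensional hx
  have : NumberField ℚ⟮x⟯ := {}
  have hn : (Module.finrank ℚ ℚ⟮x⟯) ≠ 0 := Module.finrank_pos.ne'
  rw [absLogHeight₁, absMulHeight₁, dif_pos hx]
  refine Real.log_le_log (by positivity) ?_
  calc _ ≤ (c ^ Module.finrank ℚ ℚ⟮x⟯) ^ (Module.finrank ℚ ℚ⟮x⟯ : ℝ)⁻¹ := by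
        gcongr
        exact h _ _ (IntermediateField.AdjoinSimple.coe_gen ℚ x)
    _ = c := Real.pow_rpow_inv_natCast hc.le hn

lemma absLogHeight₁_ratCast (q : ℚ) : absLogHeight₁ (q : F) = logHeight₁ q := by
  have hx : IsIntegral ℚ (q : F) := isIntegral_algebraMap (R := ℚ) (A := F) (x := q)
  have : FiniteDimensional ℚ ℚ⟮(q : F)⟯ := IntermediateField.adjoin.finiteDimensional hx
  have : NumberField ℚ⟮(q : F)⟯ := {}
  have hn : (Module.finrank ℚ ℚ⟮(q : F)⟯) ≠ 0 := Module.finrank_pos.ne'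
  have hg : IntermediateField.AdjoinSimple.gen ℚ (q : F) = (q : ℚ⟮(q : F)⟯) := by
    apply Subtype.ext
    simp
  rw [absLogHeight₁, absMulHeight₁, dif_pos hx, hg, mulHeight₁_ratCast,
    Real.pow_rpow_inv_natCast (by positivity) hn, Rat.logHeight₁_eq_log_max]
  simp

lemma absLogHeight₁_rat (q : ℚ) : absLogHeight₁ q = logHeight₁ q :=
  absLogHeight₁_ratCast (F := ℚ) q

/-- If `x / D` is a root of the nonzero integer polynomial `f`, then the height of `x` is at most
`log (D + 1)` plus the logarithm of the length of `f`. -/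
lemma absLogHeight₁_le_of_root_div {f : ℤ[X]} (hf : f ≠ 0) {D : ℕ} (hD : D ≠ 0) {x : F}
    (h : aeval (x / D) f = 0) :
    absLogHeight₁ x ≤ Real.log ((D + 1) * length f) := by
  have hDF : (D : F) ≠ 0 := Nat.cast_ne_zero.mpr hD
  have hL : 0 < length f := length_pos hf
  have hxD : IsIntegral ℚ (x / D) := by
    refine (isAlgebraic_iff_isIntegral).mp ⟨f.map (Int.castRingHom ℚ), ?_, ?_⟩
    · exact (Polynomial.map_ne_zero_iff Int.cast_injective).mpr hf
    · rw [← h, ← algebraMap_int_eq, aeval_map_algebraMap]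
  have hx : IsIntegral ℚ x := by
    have := hxD.mul (isIntegral_algebraMap (R := ℚ) (A := F) (x := (D : ℚ)))
    rwa [map_natCast, div_mul_cancel₀ _ hDF] at this
  refine absLogHeight₁_le_of_mulHeight₁_le hx (by positivity) fun K _ y hy ↦ ?_
  have hDK : (D : K) ≠ 0 := Nat.cast_ne_zero.mpr hD
  have h1 : mulHeight₁ (D : K) ≤ (D + 1 : ℝ) ^ Module.finrank ℚ K := by
    have := mulHeight₁_ratCast (K := K) (D : ℚ)
    rw [Rat.cast_natCast] at this
    rw [this]
    gcongr
    simp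
  have h2 : mulHeight₁ (y / D) ≤ length f ^ Module.finrank ℚ K := by
    refine mulHeight₁_le_length_pow hf ?_
    apply (algebraMap K F).injective
    rw [← aeval_algebraMap_apply, map_zero, ← h]
    simp [hy]
  calc mulHeight₁ y = mulHeight₁ ((D : K) * (y / D)) := by rw [mul_div_cancel₀ _ hDK]
    _ ≤ mulHeight₁ (D : K) * mulHeight₁ (y / D) := mulHeight₁_mul_le _ _
    _ ≤ _ := by rw [mul_pow]; gcongr

end AbsoluteHeights

end

section

/-! ### The quadratic forms taking x(P), x(Q) to x(P + Q), x(P - Q) -/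

section AddSub

open WeierstrassCurve WeierstrassCurve.Affine WeierstrassCurve.Affine.Point

variable {F : Type*} [Field F] {W : WeierstrassCurve.Affine F}

/-- The values of the polynomials `addSubMap W` at a vector. -/
def addSubEval (W : WeierstrassCurve.Affine F) (v : Fin 3 → F) : Fin 3 → F :=
  fun i ↦ (addSubMap W i).eval v

lemma addSubEval_short (h₁ : W.a₁ = 0) (h₂ : W.a₂ = 0) (h₃ : W.a₃ = 0) (s t u : F) :
    addSubEval W ![s, t, u] =
      ![s ^ 2 - 2 * W.a₄ * s * u - 4 * W.a₆ * t * u + W.a₄ ^ 2 * u ^ 2,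
        2 * t * s + 2 * W.a₄ * t * u + 4 * W.a₆ * u ^ 2, t ^ 2 - 4 * s * u] := by
  ext i
  fin_cases i <;> simp [addSubEval, addSubMap, b₂, b₄, b₆, b₈, h₁, h₂, h₃]

variable [DecidableEq F]

/-- The scalar is the squared denominator 4y² of the tangent slope. At a point of order two this
vanishes, and the square of 3x² + a₄, nonzero by nonsingularity, replaces it. -/
lemma addSubEval_sym2x_self (hF : (2 : F) ≠ 0) (h₁ : W.a₁ = 0) (h₂ : W.a₂ = 0) (h₃ : W.a₃ = 0)
    (P : W.Point) :
    ∃ c : F, c ≠ 0 ∧ addSubEval W (P.sym2x P) = c • (P + P).sym2x 0 := by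
  rcases P with _ | ⟨x, y, h⟩
  · refine ⟨1, one_ne_zero, ?_⟩
    rw [← zero_def, add_zero, sym2x_zero_zero, addSubEval_short h₁ h₂ h₃]
    simp
  · have hn := h
    rw [nonsingular_iff, equation_iff, h₁, h₂, h₃] at hn
    obtain ⟨heq, hns⟩ := hn
    have hneg : W.negY x y = -y := by simp [negY, h₁, h₃]
    rw [sym2x_some_some, addSubEval_short h₁ h₂ h₃]
    by_cases hy : y = 0
    · have hd : 3 * x ^ 2 + W.a₄ ≠ 0 := by
        intro h0
        rcases hns with hns | hns
        · apply hns; linear_combination -h0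
        · apply hns; rw [hy]; ring
      rw [add_self_of_Y_eq (by rw [hneg, hy]; simp), sym2x_zero_zero]
      refine ⟨(3 * x ^ 2 + W.a₄) ^ 2, pow_ne_zero 2 hd, ?_⟩
      subst hy
      ext i
      fin_cases i <;> simp
      · linear_combination 8 * x * heq
      · linear_combination (-4) * heq
      · ring
    · have hy' : y ≠ W.negY x y := by
        rw [hneg]
        intro h0
        exact hy ((mul_eq_zero.mp (show 2 * y = 0 by linear_combination h0)).resolve_left hF)
      rw [add_self_of_Y_ne hy', sym2x_some_zero, slope_of_Y_ne rfl hy', hneg]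
      refine ⟨4 * y ^ 2, mul_ne_zero ?_ (pow_ne_zero 2 hy), ?_⟩
      · rw [show (4 : F) = 2 * 2 by norm_num]; exact mul_ne_zero hF hF
      have hl : (3 * x ^ 2 + 2 * W.a₂ * x + W.a₄ - W.a₁ * y) / (y - -y) * (2 * y) =
          3 * x ^ 2 + W.a₄ := by
        rw [h₁, h₂, show y - -y = 2 * y by ring, div_mul_cancel₀ _ (mul_ne_zero hF hy)]
        ring
      generalize (3 * x ^ 2 + 2 * W.a₂ * x + W.a₄ - W.a₁ * y) / (y - -y) = l at hl
      ext i
      fin_cases i <;> simp [addX, h₁, h₂]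
      · linear_combination (-(l * (2 * y)) - (3 * x ^ 2 + W.a₄)) * hl + 8 * x * heq
      · linear_combination (-4) * heq
      · ring

lemma addSubEval_sym2x (hF : (2 : F) ≠ 0) (h₁ : W.a₁ = 0) (h₂ : W.a₂ = 0) (h₃ : W.a₃ = 0)
    (P Q : W.Point) :
    ∃ c : F, c ≠ 0 ∧ addSubEval W (P.sym2x Q) = c • (P + Q).sym2x (P - Q) := by
  by_cases hPQ : P = Q
  · subst hPQ
    simpa using addSubEval_sym2x_self hF h₁ h₂ h₃ P
  by_cases hPQ' : P = -Q
  · obtain ⟨c, hc, h⟩ := addSubEval_sym2x_self hF h₁ h₂ h₃ P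
    refine ⟨c, hc, ?_⟩
    obtain rfl : Q = -P := by rw [hPQ', neg_neg]
    rw [sym2x_neg_right, h, sym2x_comm]
    simp
  rcases P with _ | ⟨x₁, y₁, hP⟩
  · refine ⟨1, one_ne_zero, ?_⟩
    rcases Q with _ | ⟨x, y, h⟩
    · exact absurd rfl hPQ
    · rw [← zero_def, zero_add, zero_sub, sym2x_neg_right, sym2x_zero_some, sym2x_some_some,
        addSubEval_short h₁ h₂ h₃]
      ext i
      fin_cases i <;> simp <;> ring
  rcases Q with _ | ⟨x₂, y₂, hQ⟩
  · refine ⟨1, one_ne_zero, ?_⟩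
    rw [← zero_def, add_zero, sub_zero, sym2x_some_zero, sym2x_some_some,
      addSubEval_short h₁ h₂ h₃]
    ext i
    fin_cases i <;> simp <;> ring
  have hx : x₁ ≠ x₂ := by
    intro hx
    rcases X_eq_iff.mp hx with h | h
    · exact hPQ h
    · exact hPQ' h
  have e₁ := (equation_iff _ _).mp hP.1
  have e₂ := (equation_iff _ _).mp hQ.1
  simp only [h₁, h₂, h₃] at e₁ e₂
  have hx' : x₁ - x₂ ≠ 0 := sub_ne_zero.mpr hx
  refine ⟨(x₁ - x₂) ^ 2, pow_ne_zero 2 hx', ?_⟩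
  rw [sub_eq_add_neg (Point.some x₁ y₁ hP), neg_some, add_of_X_ne hx, add_of_X_ne hx,
    sym2x_some_some, sym2x_some_some, addSubEval_short h₁ h₂ h₃, slope_of_X_ne hx,
    slope_of_X_ne hx]
  have hl : (y₁ - y₂) / (x₁ - x₂) * (x₁ - x₂) = y₁ - y₂ := div_mul_cancel₀ _ hx'
  have hm : (y₁ - W.negY x₂ y₂) / (x₁ - x₂) * (x₁ - x₂) = y₁ + y₂ := by
    rw [div_mul_cancel₀ _ hx']
    simp [negY, h₁, h₃]
  generalize (y₁ - y₂) / (x₁ - x₂) = l at hl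
  generalize (y₁ - W.negY x₂ y₂) / (x₁ - x₂) = m at hm
  ext i
  fin_cases i <;> simp [addX, h₁, h₂]
  · have hl2 : l ^ 2 * (x₁ - x₂) ^ 2 = (y₁ - y₂) ^ 2 := by rw [← hl]; ring
    have hm2 : m ^ 2 * (x₁ - x₂) ^ 2 = (y₁ + y₂) ^ 2 := by rw [← hm]; ring
    -- With a second factor (x₁ - x₂)², the slopes enter only through their squares times (x₁ -
    -- x₂)², which `hl2` and `hm2` evaluate.
    refine mul_left_cancel₀ (pow_ne_zero 2 hx') ?_
    have e : (x₁ - x₂) ^ 2 * ((x₁ - x₂) ^ 2 * ((l ^ 2 - x₁ - x₂) * (m ^ 2 - x₁ - x₂))) =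
        (l ^ 2 * (x₁ - x₂) ^ 2 - (x₁ + x₂) * (x₁ - x₂) ^ 2) *
          (m ^ 2 * (x₁ - x₂) ^ 2 - (x₁ + x₂) * (x₁ - x₂) ^ 2) := by ring
    rw [e, hl2, hm2]
    linear_combination
      (-(y₁ ^ 2 - y₂ ^ 2 + (x₁ ^ 3 + W.a₄ * x₁) - (x₂ ^ 3 + W.a₄ * x₂)) +
        2 * (x₁ + x₂) * (x₁ - x₂) ^ 2) * e₁ +
      ((y₁ ^ 2 - y₂ ^ 2 + (x₁ ^ 3 + W.a₄ * x₁) - (x₂ ^ 3 + W.a₄ * x₂)) +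
        2 * (x₁ + x₂) * (x₁ - x₂) ^ 2) * e₂
  · linear_combination (-(l * (x₁ - x₂)) - (y₁ - y₂)) * hl -
      (m * (x₁ - x₂) + (y₁ + y₂)) * hm - 2 * e₁ - 2 * e₂
  · ring

end AddSub

end

section

open Height WeierstrassCurve WeierstrassCurve.Affine WeierstrassCurve.Affine.Point

/-! ### The tripling formula -/

section Triple

/-- The third division polynomial of `y² = x³ + a x + b`. -/
def psiThree {R : Type*} [CommRing R] (a b x : R) : R :=
  3 * x ^ 4 + 6 * a * x ^ 2 + 12 * b * x - a ^ 2

/-- The numerator of the `x`-coordinate of `3 P` on `y² = x³ + a x + b`; the denominator is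
`psiThree a b x ^ 2`. -/
def phiThree {R : Type*} [CommRing R] (a b x : R) : R :=
  x * psiThree a b x ^ 2 - 8 * (x ^ 3 + a * x + b) *
    (x ^ 6 + 5 * a * x ^ 4 + 20 * b * x ^ 3 - 5 * a ^ 2 * x ^ 2 - 4 * a * b * x - 8 * b ^ 2 - a ^ 3)

lemma map_psiThree {R S : Type*} [CommRing R] [CommRing S] (f : R →+* S) (a b x : R) :
    f (psiThree a b x) = psiThree (f a) (f b) (f x) := by
  simp only [psiThree, map_sub, map_add, map_mul, map_pow, map_ofNat]

lemma map_phiThree {R S : Type*} [CommRing R] [CommRing S] (f : R →+* S) (a b x : R) :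
    f (phiThree a b x) = phiThree (f a) (f b) (f x) := by
  simp only [phiThree, map_psiThree, map_sub, map_add, map_mul, map_pow, map_ofNat]

variable {F : Type*} [Field F] [DecidableEq F] {W : WeierstrassCurve.Affine F}

/-- The add-subtract forms are used at (P, P) and then at (2P, P). In the second case the difference
is P itself, so x(3P) can be solved for. Homogeneous coordinates also cover 3P = O. -/
lemma xRep_three_nsmul (hF : (2 : F) ≠ 0) (h₁ : W.a₁ = 0) (h₂ : W.a₂ = 0) (h₃ : W.a₃ = 0)
    {x y : F} (h : W.Nonsingular x y) :
    (3 • Point.some x y h).xRep 0 * psiThree W.a₄ W.a₆ x ^ 2 =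
      (3 • Point.some x y h).xRep 1 * phiThree W.a₄ W.a₆ x := by
  set P := Point.some x y h with hP
  obtain ⟨c, hc, hc'⟩ := addSubEval_sym2x hF h₁ h₂ h₃ P P
  obtain ⟨d, hd, hd'⟩ := addSubEval_sym2x hF h₁ h₂ h₃ (P + P) P
  rw [show P + P + P = 3 • P by abel, add_sub_cancel_right] at hd'
  rw [sub_self] at hc'
  have hxP : P.xRep = ![x, 1] := rfl
  simp only [sym2x, hxP, xRep_zero, addSubEval_short h₁ h₂ h₃] at hc' hd'
  generalize (P + P).xRep = u at hc' hd'
  generalize (3 • P).xRep = v at hd' ⊢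
  have c0 := congrFun hc' 0
  have c1 := congrFun hc' 1
  have d1 := congrFun hd' 1
  have d2 := congrFun hd' 2
  simp at c0 c1 d1 d2
  have hV : c ^ 2 * d * v 1 = psiThree W.a₄ W.a₆ x ^ 2 := by
    have : psiThree W.a₄ W.a₆ x = c * u 1 * x - c * u 0 := by
      rw [← c0, ← c1, psiThree]; ring
    rw [this]
    linear_combination (-c ^ 2) * d2
  have hU : c ^ 2 * d * v 0 = phiThree W.a₄ W.a₆ x := by
    have h1 : c ^ 2 * d * v 0 = 2 * (c * u 0 + c * u 1 * x) * (c * u 0 * x) +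
        2 * W.a₄ * (c * u 0 + c * u 1 * x) * (c * u 1) + 4 * W.a₆ * (c * u 1) ^ 2 -
        x * (c ^ 2 * d * v 1) := by
      linear_combination (-c ^ 2) * d1
    rw [h1, hV, ← c0, ← c1, phiThree, psiThree]
    ring
  rw [← hU, ← hV]
  ring

end Triple

section TwistCoefficients

variable (A B : ℤ) (D : ℕ) (F : Type) [Field F]

lemma twist_a₁ : ((twist A B D)⁄F).a₁ = 0 := by simp [twist]
lemma twist_a₂ : ((twist A B D)⁄F).a₂ = 0 := by simp [twist]
lemma twist_a₃ : ((twist A B D)⁄F).a₃ = 0 := by simp [twist]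
lemma twist_a₄ : ((twist A B D)⁄F).a₄ = (D : F) ^ 2 * A := by
  simp [twist]
lemma twist_a₆ : ((twist A B D)⁄F).a₆ = (D : F) ^ 3 * B := by
  simp [twist]

lemma twist_Δ : ((twist A B D)⁄F).Δ = -16 * (D : F) ^ 6 * ((4 * A ^ 3 + 27 * B ^ 2 : ℤ) : F) := by
  simp only [Δ, b₂, b₄, b₆, b₈, twist_a₁, twist_a₂, twist_a₃, twist_a₄, twist_a₆]
  push_cast
  ring

variable {A B D}

lemma twist_Δ_ne_zero [CharZero F] (hE : 4 * A ^ 3 + 27 * B ^ 2 ≠ 0) (hD : D ≠ 0) :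
    ((twist A B D)⁄F).Δ ≠ 0 := by
  rw [twist_Δ]
  have h1 : (D : F) ≠ 0 := Nat.cast_ne_zero.mpr hD
  have h2 : ((4 * A ^ 3 + 27 * B ^ 2 : ℤ) : F) ≠ 0 := Int.cast_ne_zero.mpr hE
  exact mul_ne_zero (mul_ne_zero (by norm_num) (pow_ne_zero 6 h1)) h2

variable {F}

lemma equation_twist {x y : F} (h : ((twist A B D)⁄F).Nonsingular x y) :
    y ^ 2 = x ^ 3 + (D : F) ^ 2 * A * x + (D : F) ^ 3 * B := by
  simpa [twist] using (equation_iff _ _).mp h.1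

end TwistCoefficients

/-! ### The parallelogram law for the height of x/D -/

section Parallelogram

variable {A B : ℤ} {D : ℕ}

/-- Homogeneous coordinates of `x(P) / D`. -/
def scaledX (P : Pt A B D ℚ) : Fin 2 → ℚ := ![P.xRep 0, D * P.xRep 1]

/-- The logarithmic height of `x(P) / D`. -/
def scaledHeight (P : Pt A B D ℚ) : ℝ := logHeight (scaledX P)

lemma scaledX_ne_zero (hD : D ≠ 0) (P : Pt A B D ℚ) : ![scaledX P 0, scaledX P 1] ≠ 0 := by
  have : (D : ℚ) ≠ 0 := Nat.cast_ne_zero.mpr hD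
  rcases P with _ | ⟨x, y, h⟩
  · exact fun h ↦ by simpa [scaledX, xRep] using congrFun h 0
  · exact fun h ↦ by simpa [scaledX, xRep, hD] using congrFun h 1

/-- Homogeneous coordinates of the elementary symmetric functions of `x(P) / D`, `x(Q) / D`. -/
def scaledSym (P Q : Pt A B D ℚ) : Fin 3 → ℚ :=
  ![scaledX P 0 * scaledX Q 0, scaledX P 0 * scaledX Q 1 + scaledX P 1 * scaledX Q 0,
    scaledX P 1 * scaledX Q 1]

lemma scaledSym_eq (P Q : Pt A B D ℚ) :
    scaledSym P Q = ![P.sym2x Q 0, D * P.sym2x Q 1, D ^ 2 * P.sym2x Q 2] := by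
  ext i
  fin_cases i <;> simp [scaledSym, scaledX, sym2x] <;> ring

/-- Giving x, a₄, a₆ the weights 1, 2, 3 makes the forms homogeneous, so rescaling by D turns the
forms of E_D into those of E. This is the source of uniformity in D. -/
lemma addSubEval_scaledSym (P Q : Pt A B D ℚ) :
    ∃ c : ℚ, c ≠ 0 ∧
      addSubEval ((twist A B 1)⁄ℚ) (scaledSym P Q) = c • scaledSym (P + Q) (P - Q) := by
  obtain ⟨c, hc, h⟩ := addSubEval_sym2x (W := (twist A B D)⁄ℚ) two_ne_zero (twist_a₁ ..)
    (twist_a₂ ..) (twist_a₃ ..) P Q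
  refine ⟨c, hc, ?_⟩
  rw [scaledSym_eq, scaledSym_eq, addSubEval_short (twist_a₁ ..) (twist_a₂ ..) (twist_a₃ ..)]
  generalize P.sym2x Q = v at h
  generalize (P + Q).sym2x (P - Q) = w at h
  rw [show v = ![v 0, v 1, v 2] by ext i; fin_cases i <;> rfl,
    addSubEval_short (twist_a₁ ..) (twist_a₂ ..) (twist_a₃ ..)] at h
  have e0 := congrFun h 0
  have e1 := congrFun h 1
  have e2 := congrFun h 2
  simp [twist] at e0 e1 e2
  ext i
  fin_cases i <;> simp [twist]
  · linear_combination e0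
  · linear_combination (D : ℚ) * e1
  · linear_combination (D : ℚ) ^ 2 * e2

/-- The approximate parallelogram law on `E_D(ℚ)` with error at most `C`. -/
def ParallelogramBound (A B : ℤ) (D : ℕ) (C : ℝ) : Prop := ∀ P Q : Pt A B D ℚ,
  |scaledHeight (P + Q) + scaledHeight (P - Q) - 2 * (scaledHeight P + scaledHeight Q)| ≤ C

/-- The approximate parallelogram law, uniformly in the quadratic twists of a fixed curve. -/
lemma exists_parallelogram (hE : 4 * A ^ 3 + 27 * B ^ 2 ≠ 0) :
    ∃ C : ℝ, ∀ D : ℕ, D ≠ 0 → ParallelogramBound A B D C := by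
  have : ((twist A B 1)⁄ℚ).IsElliptic :=
    ⟨isUnit_iff_ne_zero.mpr (twist_Δ_ne_zero ℚ hE one_ne_zero)⟩
  obtain ⟨C₁, hC₁⟩ := abs_logHeight_addSubMap_sub_two_mul_logHeight_le ((twist A B 1)⁄ℚ)
  obtain ⟨C₂, hC₂⟩ := abs_logHeight_sym2_sub_le ℚ
  refine ⟨C₁ + 3 * C₂, fun D hD P Q ↦ ?_⟩
  have hs (P : Pt A B D ℚ) : logHeight ![scaledX P 0, scaledX P 1] = scaledHeight P := rfl
  have h1 := hC₁ (scaledSym P Q)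
  have h2 := hC₂ (scaledX_ne_zero hD P) (scaledX_ne_zero hD Q)
  have h3 := hC₂ (scaledX_ne_zero hD (P + Q)) (scaledX_ne_zero hD (P - Q))
  obtain ⟨c, hc, h⟩ := addSubEval_scaledSym P Q
  change |logHeight (addSubEval ((twist A B 1)⁄ℚ) (scaledSym P Q)) - _| ≤ _ at h1
  rw [h, logHeight_smul_eq_logHeight _ hc] at h1
  rw [hs, hs] at h2 h3
  change |logHeight (scaledSym P Q) - _| ≤ _ at h2
  change |logHeight (scaledSym (P + Q) (P - Q)) - _| ≤ _ at h3
  rw [abs_le] at *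
  constructor <;> linarith [h1.1, h1.2, h2.1, h2.2, h3.1, h3.2]

lemma height_nonneg (P : Pt A B D ℚ) : 0 ≤ height P := by
  rcases P with _ | ⟨x, y, h⟩
  · exact le_rfl
  · rw [height, absLogHeight₁_rat]
    exact zero_le_logHeight₁ _

lemma scaledHeight_nonneg (P : Pt A B D ℚ) : 0 ≤ scaledHeight P := logHeight_nonneg _

lemma scaledHeight_zero : scaledHeight (0 : Pt A B D ℚ) = 0 := by
  have : scaledX (0 : Pt A B D ℚ) = ![(0 : ℚ) + 1, 0] := by
    ext i; fin_cases i <;> simp [scaledX]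
  rw [scaledHeight, this, zero_add, logHeight_swap, ← logHeight₁_eq_logHeight, logHeight₁_zero]

lemma abs_scaledHeight_sub_height_le (hD : D ≠ 0) (P : Pt A B D ℚ) :
    |scaledHeight P - height P| ≤ Real.log D := by
  have : NeZero D := ⟨hD⟩
  have hD' : (D : ℚ) ≠ 0 := Nat.cast_ne_zero.mpr hD
  rcases P with _ | ⟨x, y, h⟩
  · change |scaledHeight (0 : Pt A B D ℚ) - 0| ≤ _
    rw [scaledHeight_zero, sub_zero, abs_zero]
    exact Real.log_natCast_nonneg D
  · have h1 : scaledHeight (Point.some x y h : Pt A B D ℚ) = logHeight₁ (x / D) := by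
      rw [logHeight₁_div_eq_logHeight, scaledHeight]
      congr 1
      ext i; fin_cases i <;> simp [scaledX]
    have h2 : height (Point.some x y h : Pt A B D ℚ) = logHeight₁ x := absLogHeight₁_rat x
    have h3 := logHeight₁_mul_le (x / D) (D : ℚ)
    have h4 := logHeight₁_mul_le x (D : ℚ)⁻¹
    rw [div_mul_cancel₀ _ hD', Rat.logHeight₁_natCast] at h3
    rw [logHeight₁_inv, Rat.logHeight₁_natCast, ← div_eq_mul_inv] at h4
    rw [h1, h2, abs_le]
    constructor <;> linarith

end Parallelogram

end

section

open Height NumberField WeierstrassCurve WeierstrassCurve.Affine WeierstrassCurve.Affine.Point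

/-! ### The tripling polynomial and the height of a third -/

section TriplePolynomial

open Polynomial

variable {R : Type*} [CommRing R]

/-- The polynomial whose roots are the `x`-coordinates of the points `T` on `y² = x³ + a x + b`
with `x(3 T) = n / m`. -/
def triplePoly (a b m n : R) : R[X] :=
  C m * phiThree (C a) (C b) X - C n * psiThree (C a) (C b) X ^ 2

lemma triplePoly_eq (a b m n : R) : ∃ g : R[X], g.natDegree ≤ 7 ∧
    triplePoly a b m n = C m * X ^ 9 - C (9 * n) * X ^ 8 + g := by
  refine ⟨C (-12 * m * a) * X ^ 7 + C (-96 * m * b - 36 * n * a) * X ^ 6 +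
    C (30 * m * a ^ 2 - 72 * n * b) * X ^ 5 + C (-24 * m * a * b - 30 * n * a ^ 2) * X ^ 4 +
    C (36 * m * a ^ 3 + 48 * m * b ^ 2 - 144 * n * a * b) * X ^ 3 +
    C (48 * m * a ^ 2 * b + 12 * n * a ^ 3 - 144 * n * b ^ 2) * X ^ 2 +
    C (9 * m * a ^ 4 + 96 * m * a * b ^ 2 + 24 * n * a ^ 2 * b) * X +
    C (8 * m * a ^ 3 * b + 64 * m * b ^ 3 - n * a ^ 4), by compute_degree, ?_⟩
  simp only [triplePoly, phiThree, psiThree, map_sub, map_add, map_mul, map_pow, map_neg,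
    map_ofNat]
  ring

lemma natDegree_triplePoly_le (a b m n : R) : (triplePoly a b m n).natDegree ≤ 9 := by
  obtain ⟨g, hg, h⟩ := triplePoly_eq a b m n
  rw [h]
  compute_degree
  omega

lemma coeff_triplePoly_nine (a b m n : R) : (triplePoly a b m n).coeff 9 = m := by
  obtain ⟨g, hg, h⟩ := triplePoly_eq a b m n
  rw [h, coeff_add, coeff_sub, coeff_C_mul, coeff_C_mul]
  simp [coeff_eq_zero_of_natDegree_lt (show g.natDegree < 9 by omega), coeff_X_pow]

lemma coeff_triplePoly_eight (a b m n : R) : (triplePoly a b m n).coeff 8 = -(9 * n) := by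
  obtain ⟨g, hg, h⟩ := triplePoly_eq a b m n
  rw [h, coeff_add, coeff_sub, coeff_C_mul, coeff_C_mul]
  simp [coeff_eq_zero_of_natDegree_lt (show g.natDegree < 8 by omega), coeff_X_pow]

lemma aeval_triplePoly {S : Type*} [CommRing S] [Algebra R S] (a b m n : R) (x : S) :
    aeval x (triplePoly a b m n) =
      algebraMap R S m * phiThree (algebraMap R S a) (algebraMap R S b) x -
        algebraMap R S n * psiThree (algebraMap R S a) (algebraMap R S b) x ^ 2 := by
  have h1 := map_phiThree (aeval (R := R) x).toRingHom (C a) (C b) X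
  have h2 := map_psiThree (aeval (R := R) x).toRingHom (C a) (C b) X
  simp only [AlgHom.toRingHom_eq_coe, RingHom.coe_coe, aeval_C, aeval_X] at h1 h2
  rw [triplePoly, map_sub, map_mul, map_mul, map_pow, aeval_C, aeval_C, h1, h2]

end TriplePolynomial

variable {A B : ℤ} {D : ℕ}

lemma psiThree_scale {R : Type*} [CommRing R] (a b d x : R) :
    psiThree (d ^ 2 * a) (d ^ 3 * b) (d * x) = d ^ 4 * psiThree a b x := by
  simp only [psiThree]; ring

lemma phiThree_scale {R : Type*} [CommRing R] (a b d x : R) :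
    phiThree (d ^ 2 * a) (d ^ 3 * b) (d * x) = d ^ 9 * phiThree a b x := by
  simp only [phiThree, psiThree]; ring

lemma phiThree_eq_of_three_nsmul_eq {F : Type} [Field F] [CharZero F] [DecidableEq F]
    {x y x' y' : F} {h : ((twist A B D)⁄F).Nonsingular x y}
    {h' : ((twist A B D)⁄F).Nonsingular x' y'}
    (h3 : 3 • Point.some x y h = Point.some x' y' h') :
    x' * psiThree ((D : F) ^ 2 * A) ((D : F) ^ 3 * B) x ^ 2 =
      phiThree ((D : F) ^ 2 * A) ((D : F) ^ 3 * B) x := by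
  have := xRep_three_nsmul two_ne_zero (twist_a₁ A B D F) (twist_a₂ A B D F) (twist_a₃ A B D F) h
  rw [h3, twist_a₄, twist_a₆] at this
  simpa using this

/-- The height of a point `S` with `3 S = R` is bounded in terms of the height of `R`. -/
lemma exists_height_third_le (A B : ℤ) :
    ∃ C : ℝ, ∀ D : ℕ, D ≠ 0 → ∀ R : Pt A B D ℚ, R ≠ 0 → ∀ S ∈ third R,
      height S ≤ height R + 2 * Real.log (D + 1) + C := by
  classical
  set c : ℝ := length (phiThree (Polynomial.C A) (Polynomial.C B) Polynomial.X) +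
    length (psiThree (Polynomial.C A) (Polynomial.C B) Polynomial.X ^ 2) + 1 with hc
  have hl1 := length_nonneg (phiThree (Polynomial.C A) (Polynomial.C B) Polynomial.X)
  have hl2 := length_nonneg (psiThree (Polynomial.C A) (Polynomial.C B) Polynomial.X ^ 2)
  have hc0 : 0 < c := by positivity
  refine ⟨Real.log c, fun D hD R hR S hS ↦ ?_⟩
  have hDQ : (D : Qbar) ≠ 0 := Nat.cast_ne_zero.mpr hD
  rcases R with _ | ⟨r, r', hr⟩
  · exact absurd rfl hR
  rcases S with _ | ⟨x, y, hx⟩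
  · exfalso
    have h0 : 3 • (Point.zero : Pt A B D Qbar) = 0 := smul_zero 3
    exact some_ne_zero _ (hS.symm.trans h0)
  have hdQ : (r.den : Qbar) ≠ 0 := Nat.cast_ne_zero.mpr r.den_nz
  have hr' : (algebraMap ℚ Qbar r) * r.den = r.num := by
    rw [eq_ratCast]
    exact_mod_cast congrArg (Rat.cast (K := Qbar)) (Rat.mul_den_eq_num r)
  have h3 := phiThree_eq_of_three_nsmul_eq (hS.trans (map_some _ hr))
  have hxD : x = D * (x / D) := (mul_div_cancel₀ _ hDQ).symm
  rw [hxD, psiThree_scale, phiThree_scale] at h3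
  -- Dividing x-coordinates by D, the equation becomes that of E over r / D = r.num / (r.den * D).
  -- One log(D + 1) comes from this denominator, the other from returning to x = D (x / D).
  set f := triplePoly A B (r.den * D : ℤ) r.num with hf
  have hf0 : f ≠ 0 := by
    intro h0
    have := coeff_triplePoly_nine A B (r.den * D : ℤ) r.num
    rw [← hf, h0, Polynomial.coeff_zero] at this
    have h1 : r.den * D = 0 := by exact_mod_cast this.symm
    exact (mul_ne_zero r.den_nz hD) h1
  have hroot : Polynomial.aeval (x / D) f = 0 := by
    rw [hf, aeval_triplePoly]
    simp only [eq_intCast]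
    refine mul_left_cancel₀ (pow_ne_zero 8 hDQ) ?_
    push_cast
    rw [← hr']
    change algebraMap ℚ Qbar r * _ = _ at h3
    linear_combination (-(r.den : Qbar)) * h3
  have hlen : length f ≤ (D + 1) * (max r.num.natAbs r.den : ℕ) * c := by
    refine (length_C_mul_sub_C_mul_le _ _ _ _).trans ?_
    have e1 : |(((r.den * D : ℤ)) : ℝ)| ≤ (D + 1) * (max r.num.natAbs r.den : ℕ) := by
      push_cast
      rw [abs_of_nonneg (by positivity), mul_comm]
      gcongr
      · linarith
      · exact le_max_right _ _
    have e2 : |(r.num : ℝ)| ≤ (D + 1) * (max r.num.natAbs r.den : ℕ) := by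
      have : |(r.num : ℝ)| ≤ (max r.num.natAbs r.den : ℕ) := by
        rw [← Int.cast_abs, Int.abs_eq_natAbs, Int.cast_natCast]
        exact Nat.cast_le.mpr (le_max_left _ _)
      nlinarith [abs_nonneg (r.num : ℝ), Nat.cast_nonneg (α := ℝ) D]
    rw [hc, mul_add, mul_add]
    have e3 : (0 : ℝ) ≤ (D + 1) * (max r.num.natAbs r.den : ℕ) * 1 := by positivity
    nlinarith [mul_le_mul_of_nonneg_right e1 hl1, mul_le_mul_of_nonneg_right e2 hl2]
  have hmax : (0 : ℝ) < (max r.num.natAbs r.den : ℕ) :=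
    Nat.cast_pos.mpr (lt_max_of_lt_right r.den_pos)
  have hlenpos : 0 < length f := length_pos hf0
  clear_value f c
  change absLogHeight₁ x ≤ absLogHeight₁ r + _ + _
  rw [absLogHeight₁_rat, Rat.logHeight₁_eq_log_max]
  refine (absLogHeight₁_le_of_root_div hf0 hD hroot).trans ?_
  have hD1 : (0 : ℝ) < D + 1 := by positivity
  generalize ((max r.num.natAbs r.den : ℕ) : ℝ) = k at hmax hlen ⊢
  calc Real.log ((D + 1) * length f)
      ≤ Real.log ((D + 1) * ((D + 1) * k * c)) :=
        Real.log_le_log (by positivity) (mul_le_mul_of_nonneg_left hlen hD1.le)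
    _ = _ := by
        rw [Real.log_mul hD1.ne' (by positivity), Real.log_mul (by positivity) hc0.ne',
          Real.log_mul hD1.ne' hmax.ne']
        ring

end

section

open WeierstrassCurve WeierstrassCurve.Affine WeierstrassCurve.Affine.Point

/-! ### Archimedean estimates near infinity -/

section ComplexBounds

/-- Translating a point `(x, -y)` of bounded size by a point `(X, Y)` close to infinity changes the
`x`-coordinate by at most a multiple of `1 / √|X|`. -/
lemma norm_addX_sub_le {a b x y X Y : ℂ} {m : ℝ} (hm : 1 ≤ m) (ha : ‖a‖ ≤ m ^ 2)
    (hb : ‖b‖ ≤ m ^ 2) (hx : ‖x‖ ≤ m) (hX : 4 * m ≤ ‖X‖) (hxy : y ^ 2 = x ^ 3 + a * x + b)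
    (hXY : Y ^ 2 = X ^ 3 + a * X + b) :
    ‖((Y + y) / (X - x)) ^ 2 - X - x - x‖ ≤ 56 * m ^ 2 / √‖X‖ := by
  set T := ‖X‖ with hT
  set q := √T with hq
  have hT4 : 4 ≤ T := by linarith
  have hqT : q ^ 2 = T := Real.sq_sqrt (by linarith)
  have hq1 : 1 ≤ q := by rw [hq]; exact Real.one_le_sqrt.mpr (by linarith)
  have hy2 : ‖y‖ ^ 2 ≤ 3 * m ^ 3 := by
    rw [← norm_pow, hxy]
    calc ‖x ^ 3 + a * x + b‖ ≤ m ^ 3 + m ^ 2 * m + m ^ 2 :=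
          norm_add_le_of_le (norm_add_le_of_le (by rw [norm_pow]; gcongr)
            (by rw [norm_mul]; gcongr)) hb
      _ ≤ 3 * m ^ 3 := by nlinarith [sq_nonneg m]
  have hy : ‖y‖ ≤ 2 * m ^ 2 := by
    refine abs_le_of_sq_le_sq' ?_ (by positivity) |>.2
    refine hy2.trans ?_
    nlinarith [pow_pos (by linarith : 0 < m) 3]
  have hY : ‖Y‖ ≤ 2 * (T * q) := by
    refine abs_le_of_sq_le_sq' ?_ (by positivity) |>.2
    rw [mul_pow, mul_pow, hqT, ← norm_pow, hXY]
    have h1 : m ≤ T / 4 := by linarith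
    calc ‖X ^ 3 + a * X + b‖ ≤ T ^ 3 + m ^ 2 * T + m ^ 2 :=
          norm_add_le_of_le (norm_add_le_of_le (by rw [norm_pow])
            (by rw [norm_mul]; gcongr)) hb
      _ ≤ T ^ 3 + (T / 4) ^ 2 * T + (T / 4) ^ 2 := by gcongr
      _ ≤ 2 ^ 2 * (T ^ 2 * T) := by nlinarith [sq_nonneg T]
  have hXx : T / 2 ≤ ‖X - x‖ := by
    have := norm_sub_norm_le X x
    linarith
  have hne : X - x ≠ 0 := by
    rw [← norm_pos_iff]; linarith
  -- The terms X³ and X²x cancel, so the numerator is of order |X|^(3/2), from 2Yy, against a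
  -- denominator of order |X|².
  have key : ((Y + y) / (X - x)) ^ 2 - X - x - x =
      (2 * Y * y + (3 * x ^ 2 + a) * X + (y ^ 2 + b - 2 * x ^ 3)) / (X - x) ^ 2 := by
    rw [eq_div_iff (pow_ne_zero 2 hne), sub_mul, sub_mul, sub_mul, ← mul_pow,
      div_mul_cancel₀ _ hne]
    linear_combination hXY
  have hN : ‖2 * Y * y + (3 * x ^ 2 + a) * X + (y ^ 2 + b - 2 * x ^ 3)‖ ≤
      14 * m ^ 2 * (T * q) := by
    calc _ ≤ 2 * (2 * (T * q)) * (2 * m ^ 2) + (3 * m ^ 2 + m ^ 2) * T +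
          (3 * m ^ 3 + m ^ 2 + 2 * m ^ 3) := by
          refine norm_add_le_of_le (norm_add_le_of_le ?_ ?_)
            (norm_sub_le_of_le (norm_add_le_of_le ?_ hb) ?_)
          · rw [norm_mul, norm_mul, RCLike.norm_ofNat]; gcongr
          · rw [norm_mul]
            gcongr
            refine norm_add_le_of_le ?_ ha
            rw [norm_mul, norm_pow, RCLike.norm_ofNat]; gcongr
          · rw [norm_pow]; exact hy2
          · rw [norm_mul, norm_pow, RCLike.norm_ofNat]; gcongr
      _ ≤ 8 * m ^ 2 * (T * q) + 6 * m ^ 2 * T := by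
          nlinarith [mul_le_mul_of_nonneg_left hX (sq_nonneg m),
            mul_le_mul_of_nonneg_left hm (sq_nonneg m)]
      _ ≤ 14 * m ^ 2 * (T * q) := by
          have : 0 ≤ m ^ 2 * T := by positivity
          nlinarith [mul_le_mul_of_nonneg_left hq1 this]
  rw [key, norm_div, norm_pow]
  calc _ ≤ 14 * m ^ 2 * (T * q) / (T / 2) ^ 2 := by gcongr
    _ = 56 * m ^ 2 / q := by
        rw [← hqT]
        field_simp
        norm_num

lemma psiThree_one_bounds {α β : ℂ} (hα : ‖α‖ ≤ 1 / 10000) (hβ : ‖β‖ ≤ 1 / 10000) :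
    1 ≤ ‖psiThree α β 1‖ ∧ ‖psiThree α β 1‖ ≤ 4 := by
  have h : psiThree α β 1 = 3 + (6 * α + 12 * β - α ^ 2) := by rw [psiThree]; ring
  have h1 : ‖6 * α + 12 * β - α ^ 2‖ ≤ 6 * (1 / 10000) + 12 * (1 / 10000) + (1 / 10000) ^ 2 := by
    refine norm_sub_le_of_le (norm_add_le_of_le ?_ ?_) ?_
    · rw [norm_mul, RCLike.norm_ofNat]; gcongr
    · rw [norm_mul, RCLike.norm_ofNat]; gcongr
    · rw [norm_pow]; gcongr
  have h3 : ‖(3 : ℂ)‖ = 3 := RCLike.norm_ofNat 3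
  have h4 := norm_add_le (3 : ℂ) (6 * α + 12 * β - α ^ 2)
  have h5 := norm_sub_le_norm_add (3 : ℂ) (6 * α + 12 * β - α ^ 2)
  rw [h]
  constructor <;> norm_num at * <;> linarith

/-- Homogeneity reduces large x to x = 1 with tiny coefficients, where φ₃ is near 1 and ψ₃ near 3;
thus x(3P) is about x(P)/9. The crude bounds 1/2 and 4 yield the factor 32 = 4² / (1/2) in
`norm_le_of_triple`. -/
lemma phiThree_one_bound {α β : ℂ} (hα : ‖α‖ ≤ 1 / 10000) (hβ : ‖β‖ ≤ 1 / 10000) :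
    1 / 2 ≤ ‖phiThree α β 1‖ := by
  have h : phiThree α β 1 = 1 + (α * (30 * (α ^ 1 * β ^ 0) - 12 * (α ^ 0 * β ^ 0) -
      24 * (α ^ 0 * β ^ 1) + 36 * (α ^ 2 * β ^ 0) + 48 * (α ^ 1 * β ^ 1) + 9 * (α ^ 3 * β ^ 0) +
      96 * (α ^ 0 * β ^ 2) + 8 * (α ^ 2 * β ^ 1)) +
      β * (48 * (α ^ 0 * β ^ 1) - 96 * (α ^ 0 * β ^ 0) + 64 * (α ^ 0 * β ^ 2))) := by
    rw [phiThree, psiThree]; ring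
  have hij (i j : ℕ) : ‖α ^ i * β ^ j‖ ≤ 1 := by
    rw [norm_mul, norm_pow, norm_pow]
    exact mul_le_one₀ (pow_le_one₀ (norm_nonneg _) (by linarith)) (by positivity)
      (pow_le_one₀ (norm_nonneg _) (by linarith))
  have ht (n : ℕ) [n.AtLeastTwo] (i j : ℕ) :
      ‖(OfNat.ofNat n : ℂ) * (α ^ i * β ^ j)‖ ≤ OfNat.ofNat n := by
    rw [norm_mul, RCLike.norm_ofNat]
    exact mul_le_of_le_one_right (Nat.ofNat_nonneg _) (hij i j)
  rw [h]
  generalize hr : α * _ + β * _ = r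
  have h1 : ‖r‖ ≤ 1 / 10000 * (30 + 12 + 24 + 36 + 48 + 9 + 96 + 8) +
      1 / 10000 * (48 + 96 + 64) := by
    rw [← hr]
    refine norm_add_le_of_le ?_ ?_ <;> rw [norm_mul] <;> gcongr
    · exact norm_add_le_of_le (norm_add_le_of_le (norm_add_le_of_le (norm_add_le_of_le
        (norm_add_le_of_le (norm_sub_le_of_le (norm_sub_le_of_le (ht ..) (ht ..)) (ht ..))
        (ht ..)) (ht ..)) (ht ..)) (ht ..)) (ht ..)
    · exact norm_add_le_of_le (norm_sub_le_of_le (ht ..) (ht ..)) (ht ..)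
  have h5 := norm_sub_le_norm_add (1 : ℂ) r
  norm_num at *
  linarith

lemma exists_scaled_coefficients {a b x : ℂ} {m : ℝ} (hm : 1 ≤ m) (ha : ‖a‖ ≤ m ^ 2)
    (hb : ‖b‖ ≤ m ^ 2) (hx : 100 * m ≤ ‖x‖) :
    ∃ α β : ℂ, ‖α‖ ≤ 1 / 10000 ∧ ‖β‖ ≤ 1 / 10000 ∧ a = x ^ 2 * α ∧ b = x ^ 3 * β := by
  have h0 : 0 < ‖x‖ := by linarith
  have hx0 : x ≠ 0 := norm_pos_iff.mp h0
  refine ⟨a / x ^ 2, b / x ^ 3, ?_, ?_, (mul_div_cancel₀ _ (pow_ne_zero 2 hx0)).symm,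
    (mul_div_cancel₀ _ (pow_ne_zero 3 hx0)).symm⟩
  · rw [norm_div, norm_pow, div_le_iff₀ (by positivity)]
    nlinarith
  · rw [norm_div, norm_pow, div_le_iff₀ (by positivity)]
    have : (100 * m) ^ 2 * 1 ≤ ‖x‖ ^ 2 * ‖x‖ := by gcongr; linarith
    nlinarith

lemma psiThree_ne_zero {a b x : ℂ} {m : ℝ} (hm : 1 ≤ m) (ha : ‖a‖ ≤ m ^ 2)
    (hb : ‖b‖ ≤ m ^ 2) (hx : 100 * m ≤ ‖x‖) : psiThree a b x ≠ 0 := by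
  obtain ⟨α, β, hα, hβ, rfl, rfl⟩ := exists_scaled_coefficients hm ha hb hx
  have h := psiThree_scale α β x 1
  have h0 : x ≠ 0 := norm_pos_iff.mp (by linarith)
  rw [mul_one] at h
  rw [h]
  refine mul_ne_zero (pow_ne_zero 4 h0) ?_
  rw [← norm_pos_iff]
  linarith [(psiThree_one_bounds hα hβ).1]

/-- Tripling a point with large `x`-coordinate yields a point with large `x`-coordinate. -/
lemma norm_le_of_triple {a b x x' : ℂ} {m : ℝ} (hm : 1 ≤ m) (ha : ‖a‖ ≤ m ^ 2)
    (hb : ‖b‖ ≤ m ^ 2) (hx : 100 * m ≤ ‖x‖) (h : x' * psiThree a b x ^ 2 = phiThree a b x) :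
    ‖x‖ ≤ 32 * ‖x'‖ := by
  obtain ⟨α, β, hα, hβ, rfl, rfl⟩ := exists_scaled_coefficients hm ha hb hx
  have h1 := psiThree_scale α β x 1
  have h2 := phiThree_scale α β x 1
  have h0 : 0 < ‖x‖ := by linarith
  rw [mul_one] at h1 h2
  rw [h1, h2] at h
  have h3 := congrArg norm h
  simp only [norm_mul, norm_pow] at h3
  have h4 := (psiThree_one_bounds hα hβ).2
  have h5 := phiThree_one_bound hα hβ
  have h6 : ‖x‖ ^ 8 * (‖x‖ * ‖phiThree α β 1‖) = ‖x‖ ^ 8 * (‖x'‖ * ‖psiThree α β 1‖ ^ 2) := by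
    linear_combination -h3
  have h7 := mul_left_cancel₀ (pow_pos h0 8).ne' h6
  have h8 : ‖x'‖ * ‖psiThree α β 1‖ ^ 2 ≤ ‖x'‖ * 4 ^ 2 := by gcongr
  nlinarith

end ComplexBounds

/-! ### A third of P close to infinity -/

section LargeThird

variable {A B : ℤ} {D : ℕ}

lemma norm_map_multiset_sum_lt {K : Type*} [Field K] (ι : K →+* ℂ) {r : ℝ} (s : Multiset K)
    (hs : s ≠ 0) (h : ∀ w ∈ s, ‖ι w‖ < r) : ‖ι s.sum‖ < s.card * r := by
  induction s using Multiset.induction_on with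
  | empty => exact absurd rfl hs
  | cons a s ih =>
    rw [Multiset.sum_cons, map_add, Multiset.card_cons]
    have ha := h a (Multiset.mem_cons_self a s)
    have h1 := norm_add_le (ι a) (ι s.sum)
    push_cast
    rcases eq_or_ne s 0 with rfl | hs0
    · simpa using ha
    · have := ih hs0 fun w hw ↦ h w (Multiset.mem_cons_of_mem hw)
      linarith

/-- The monic tripling polynomial has nine roots with sum 9t, so they cannot all be smaller than t.
-/
lemma exists_large_root {K : Type*} [Field K] [IsAlgClosed K] (ι : K →+* ℂ) (a b t : K) :
    ∃ w : K, ‖ι t‖ ≤ ‖ι w‖ ∧ t * psiThree a b w ^ 2 = phiThree a b w := by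
  have hd : (triplePoly a b 1 t).natDegree = 9 :=
    le_antisymm (natDegree_triplePoly_le ..)
      (Polynomial.le_natDegree_of_ne_zero (by rw [coeff_triplePoly_nine]; exact one_ne_zero))
  have hmon : (triplePoly a b 1 t).Monic := by
    rw [Polynomial.Monic, Polynomial.leadingCoeff, hd, coeff_triplePoly_nine]
  have hs := IsAlgClosed.splits (triplePoly a b 1 t)
  have hsum := hs.nextCoeff_eq_neg_sum_roots_of_monic hmon
  rw [Polynomial.nextCoeff_of_natDegree_pos (by omega), hd, coeff_triplePoly_eight,
    neg_inj] at hsum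
  have hcard := hs.natDegree_eq_card_roots
  rw [hd] at hcard
  by_contra! hcon
  have := norm_map_multiset_sum_lt ι (r := ‖ι t‖) (triplePoly a b 1 t).roots
    (by rw [← Multiset.card_pos]; omega) fun w hw ↦ by
      by_contra! hw'
      refine hcon w hw' ?_
      have := (Polynomial.mem_roots'.mp hw).2
      rw [Polynomial.IsRoot, ← Polynomial.coe_aeval_eq_eval, aeval_triplePoly] at this
      simp only [Algebra.algebraMap_self, RingHom.id_apply, one_mul] at this
      exact (sub_eq_zero.mp this).symm
  rw [← hcard, ← hsum, map_mul, norm_mul, map_ofNat, RCLike.norm_ofNat] at this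
  norm_num at this

/-- An algebraic point of large `x`-coordinate has a third whose `x`-coordinate is at least as
large. -/
lemma exists_large_third {K : Type} [Field K] [CharZero K] [IsAlgClosed K] [DecidableEq K]
    (hE : 4 * A ^ 3 + 27 * B ^ 2 ≠ 0) (hD : D ≠ 0) (ι : K →+* ℂ) {m : ℝ} (hm : 1 ≤ m)
    (ha : ‖(D : ℂ) ^ 2 * A‖ ≤ m ^ 2) (hb : ‖(D : ℂ) ^ 3 * B‖ ≤ m ^ 2) {x y : K}
    (h : ((twist A B D)⁄K).Nonsingular x y) (hx : 100 * m ≤ ‖ι x‖) :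
    ∃ (w z : K) (hw : ((twist A B D)⁄K).Nonsingular w z),
      3 • Point.some w z hw = Point.some x y h ∧ ‖ι x‖ ≤ ‖ι w‖ := by
  obtain ⟨w, hw, hroot⟩ := exists_large_root ι ((D : K) ^ 2 * A) ((D : K) ^ 3 * B) x
  obtain ⟨z, hz⟩ := IsAlgClosed.exists_pow_nat_eq (w ^ 3 + (D : K) ^ 2 * A * w + (D : K) ^ 3 * B)
    (n := 2) two_pos
  have hns : ((twist A B D)⁄K).Nonsingular w z := by
    rw [← equation_iff_nonsingular_of_Δ_ne_zero (twist_Δ_ne_zero K hE hD), equation_iff, twist_a₁,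
      twist_a₂, twist_a₃, twist_a₄, twist_a₆, hz]
    ring
  have hψ : psiThree ((D : K) ^ 2 * A) ((D : K) ^ 3 * B) w ≠ 0 := by
    intro h0
    have := map_psiThree ι ((D : K) ^ 2 * A) ((D : K) ^ 3 * B) w
    rw [h0, _root_.map_zero] at this
    refine psiThree_ne_zero hm ha hb (hx.trans hw) ?_
    simpa using this.symm
  have h3 := xRep_three_nsmul two_ne_zero (twist_a₁ A B D K) (twist_a₂ A B D K)
    (twist_a₃ A B D K) hns
  rw [twist_a₄, twist_a₆, ← hroot, ← mul_assoc] at h3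
  have h4 := mul_right_cancel₀ (pow_ne_zero 2 hψ) h3
  rcases hQ : 3 • Point.some w z hns with _ | ⟨x', y', h'⟩
  · rw [hQ] at h4
    simp [xRep] at h4
  · rw [hQ] at h4
    simp at h4
    rcases (X_eq_iff (h₁ := h') (h₂ := h)).mp h4 with h5 | h5
    · exact ⟨w, z, hns, hQ.trans h5, hw⟩
    -- The x-coordinate fixes the triple only up to sign; here the other square root is needed.
    · refine ⟨w, _, (nonsingular_neg ..).mpr hns, ?_, hw⟩
      rw [← neg_some hns, smul_neg, hQ, h5, neg_neg]

end LargeThird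

end

/-! ### Approximation of x(Q) by the x-coordinate of a third of R -/

section

open Height NumberField WeierstrassCurve WeierstrassCurve.Affine WeierstrassCurve.Affine.Point

variable {A B : ℤ} {D : ℕ}

lemma exists_some_sub_some_eq {F : Type} [Field F] [DecidableEq F] {X Y x y : F}
    {h : ((twist A B D)⁄F).Nonsingular X Y} {h' : ((twist A B D)⁄F).Nonsingular x y}
    (hx : X ≠ x) :
    ∃ (y' : F) (h'' : ((twist A B D)⁄F).Nonsingular (((Y + y) / (X - x)) ^ 2 - X - x) y'),
      Point.some X Y h - Point.some x y h' = Point.some _ y' h'' := by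
  have e : ((twist A B D)⁄F).addX X x
      (((twist A B D)⁄F).slope X x Y (((twist A B D)⁄F).negY x y)) =
      ((Y + y) / (X - x)) ^ 2 - X - x := by
    rw [slope_of_X_ne hx, addX, negY, twist_a₁, twist_a₂, twist_a₃]
    ring
  have hadd : ∃ (y' : F) (h'' : ((twist A B D)⁄F).Nonsingular (((twist A B D)⁄F).addX X x
      (((twist A B D)⁄F).slope X x Y (((twist A B D)⁄F).negY x y))) y'),
      Point.some X Y h - Point.some x y h' = Point.some _ y' h'' :=
    ⟨_, _, by rw [sub_eq_add_neg (Point.some X Y h), neg_some, add_of_X_ne hx]⟩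
  rwa [e] at hadd

lemma baseChange_some {x y : ℚ} (h : ((twist A B D)⁄ℚ).Nonsingular x y) [DecidableEq Qbar] :
    ∃ h' : ((twist A B D)⁄Qbar).Nonsingular (x : Qbar) (y : Qbar),
      WeierstrassCurve.Affine.Point.baseChange (W' := twist A B D) ℚ Qbar (Point.some x y h) =
        Point.some (x : Qbar) (y : Qbar) h' :=
  ⟨_, map_some _ h⟩

open Classical in
lemma mem_third_iff {R : Pt A B D ℚ} {T : Pt A B D Qbar} :
    T ∈ third R ↔
      3 • T = WeierstrassCurve.Affine.Point.baseChange (W' := twist A B D) ℚ Qbar R := Iff.rfl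

lemma three_nsmul_sub_map_eq {G H : Type*} [AddCommGroup G] [AddCommGroup H] (f : G →+ H)
    {p q r : G} {w : H} (h : 3 • q = p - r) (hw : 3 • w = f p) : 3 • (w - f q) = f r := by
  rw [smul_sub, hw, ← map_nsmul, ← map_sub, h, sub_sub_cancel]

/-- If `P = 3 Q + R` with `P` close to infinity, then `x(Q)` is close to the `x`-coordinate of some
third of `R`. -/
lemma exists_close_third (hE : 4 * A ^ 3 + 27 * B ^ 2 ≠ 0) (hD : D ≠ 0) (ι : Qbar →+* ℂ) {m : ℝ}
    (hm : 1 ≤ m) (ha : ‖(D : ℂ) ^ 2 * A‖ ≤ m ^ 2) (hb : ‖(D : ℂ) ^ 3 * B‖ ≤ m ^ 2)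
    {p p' q q' r r' : ℚ} {hp : ((twist A B D)⁄ℚ).Nonsingular p p'}
    {hq : ((twist A B D)⁄ℚ).Nonsingular q q'} {hr : ((twist A B D)⁄ℚ).Nonsingular r r'}
    (h : (Point.some p p' hp : Pt A B D ℚ) = 3 • Point.some q q' hq + Point.some r r' hr)
    (hrm : ‖(r : ℂ)‖ ≤ m) (hpm : (100000 * m ^ 2) ^ 2 ≤ ‖(p : ℂ)‖) :
    ∃ T ∈ third (Point.some r r' hr : Pt A B D ℚ),
      xDist ι (Point.some q q' hq : Pt A B D ℚ) T ≤ 560000 * m ^ 2 / √‖(p : ℂ)‖ := by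
  classical
  have heq {x y : ℚ} (hxy : ((twist A B D)⁄ℚ).Nonsingular x y) :
      (y : ℂ) ^ 2 = (x : ℂ) ^ 3 + (D : ℂ) ^ 2 * A * x + (D : ℂ) ^ 3 * B := by
    exact_mod_cast congrArg (Rat.cast (K := ℂ)) (equation_twist hxy)
  have hsq : 100000 * m ^ 2 ≤ √‖(p : ℂ)‖ := Real.le_sqrt_of_sq_le hpm
  have hm2 : m ≤ m ^ 2 := by nlinarith
  have hpbig : 100000 * m ≤ ‖(p : ℂ)‖ := by
    refine le_trans ?_ hpm
    nlinarith [sq_nonneg (m ^ 2)]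
  have h3Q : 3 • (Point.some q q' hq : Pt A B D ℚ) =
      (Point.some p p' hp : Pt A B D ℚ) - Point.some r r' hr := eq_sub_of_add_eq h.symm
  have hpr : p ≠ r := by
    rintro rfl
    linarith
  -- Since P is near O, x(3Q) = x(P - R) is within 1 of x(R). If x(Q) exceeded 100m,
  -- `norm_le_of_triple` would give |x(Q)| ≤ 32(m + 1) ≤ 64m.
  have hqm : ‖(q : ℂ)‖ ≤ 100 * m := by
    obtain ⟨s, hs, hs'⟩ := exists_some_sub_some_eq (h := hp) (h' := hr) hpr
    have h1 := phiThree_eq_of_three_nsmul_eq (h3Q.trans hs')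
    have h2 := congrArg (Rat.castHom ℂ) h1
    rw [map_mul, map_pow, map_psiThree, map_phiThree] at h2
    simp only [map_mul, map_pow, map_natCast, map_intCast, Rat.coe_castHom] at h2
    have h3 := norm_addX_sub_le hm ha hb hrm (by linarith) (heq hr) (heq hp)
    by_contra! hcon
    have h4 := norm_le_of_triple hm ha hb hcon.le h2
    have h5 : 56 * m ^ 2 / √‖(p : ℂ)‖ ≤ 1 := by
      rw [div_le_one (by nlinarith)]
      nlinarith
    push_cast at h4
    have h6 := norm_le_norm_add_norm_sub' ((((p' : ℂ) + r') / (p - r)) ^ 2 - p - r) (r : ℂ)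
    linarith
  obtain ⟨hp1, hp2⟩ := baseChange_some hp
  obtain ⟨hq1, hq2⟩ := baseChange_some hq
  have hιp : ι (p : Qbar) = (p : ℂ) := map_ratCast ι p
  have hιq : ι (q : Qbar) = (q : ℂ) := map_ratCast ι q
  have hιq' : ι (q' : Qbar) = (q' : ℂ) := map_ratCast ι q'
  obtain ⟨w, z, hw, hw3, hwp⟩ := exists_large_third hE hD ι hm ha hb hp1 (by rw [hιp]; linarith)
  rw [hιp] at hwp
  have hwq : w ≠ (q : Qbar) := by
    rintro rfl
    rw [hιq] at hwp
    linarith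
  obtain ⟨s, hs, hs'⟩ := exists_some_sub_some_eq (h := hw) (h' := hq1) hwq
  have hT := three_nsmul_sub_map_eq
    (WeierstrassCurve.Affine.Point.baseChange (W' := twist A B D) ℚ Qbar) h3Q (hw3.trans hp2.symm)
  rw [hq2] at hT
  refine ⟨Point.some _ s hs, mem_third_iff.mpr ((congrArg (3 • ·) hs').symm.trans hT), ?_⟩
  have hsp : 0 < √‖(p : ℂ)‖ := lt_of_lt_of_le (by positivity) hsq
  rw [xDist, norm_sub_rev]
  have hzw : (ι z) ^ 2 = (ι w) ^ 3 + (D : ℂ) ^ 2 * A * ι w + (D : ℂ) ^ 3 * B := by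
    have := congrArg ι (equation_twist hw)
    simpa using this
  have h1 := norm_addX_sub_le (m := 100 * m) (by linarith) (ha.trans (by nlinarith))
    (hb.trans (by nlinarith)) hqm (by linarith) (heq hq) hzw
  simp only [xCoord, map_sub, map_pow, map_div₀, map_add, hιq, hιq']
  refine h1.trans ?_
  rw [show 56 * (100 * m) ^ 2 = 560000 * m ^ 2 by ring]
  gcongr

lemma abs_le_exp_height {x y : ℚ} (h : ((twist A B D)⁄ℚ).Nonsingular x y) :
    |(x : ℝ)| ≤ Real.exp (height (Point.some x y h : Pt A B D ℚ)) := by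
  change _ ≤ Real.exp (absLogHeight₁ x)
  have h0 : (0 : ℝ) < (max x.num.natAbs x.den : ℕ) :=
    Nat.cast_pos.mpr (lt_max_of_lt_right x.den_pos)
  rw [absLogHeight₁_rat, Rat.logHeight₁_eq_log_max, Real.exp_log h0]
  have h1 : |(x : ℝ)| ≤ |(x.num : ℝ)| := by
    rw [Rat.cast_def, abs_div]
    refine div_le_self (abs_nonneg _) ?_
    rw [Nat.abs_cast]
    exact_mod_cast x.den_pos
  refine h1.trans ?_
  rw [← Int.cast_abs, Int.abs_eq_natAbs, Int.cast_natCast]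
  exact Nat.cast_le.mpr (le_max_left _ _)

/-- This is where integrality makes P archimedeanly close to O. Positive height excludes x = 0. -/
lemma abs_eq_exp_height {x : ℤ} {y : ℚ} (h : ((twist A B D)⁄ℚ).Nonsingular (x : ℚ) y)
    (h0 : 0 < height (Point.some _ y h : Pt A B D ℚ)) :
    |(x : ℝ)| = Real.exp (height (Point.some _ y h : Pt A B D ℚ)) := by
  change 0 < absLogHeight₁ (x : ℚ) at h0
  change _ = Real.exp (absLogHeight₁ (x : ℚ))
  rw [absLogHeight₁_rat, Rat.logHeight₁_eq_log_max, Rat.num_intCast, Rat.den_intCast] at h0 ⊢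
  have h1 : 1 ≤ x.natAbs := by
    by_contra! hlt
    rw [max_eq_right hlt.le] at h0
    simp at h0
  rw [max_eq_left h1, Real.exp_log (by exact_mod_cast h1), ← Int.cast_abs, Int.abs_eq_natAbs,
    Int.cast_natCast]

/-! ### Consequences of the parallelogram law -/

section HeightInequalities

variable {C : ℝ}

lemma abs_scaledHeight_two_nsmul_sub_le (hC : ParallelogramBound A B D C)
    (P : Pt A B D ℚ) :
    |scaledHeight (P + P) - 4 * scaledHeight P| ≤ C := by
  have := hC P P
  rw [sub_self, scaledHeight_zero] at this
  convert this using 2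
  ring

lemma abs_scaledHeight_three_nsmul_sub_le (hC : ParallelogramBound A B D C)
    (P : Pt A B D ℚ) :
    |scaledHeight (3 • P) - 9 * scaledHeight P| ≤ 3 * C := by
  have h1 := abs_scaledHeight_two_nsmul_sub_le hC P
  have h2 := hC (P + P) P
  rw [add_sub_cancel_right, show P + P + P = 3 • P by abel] at h2
  rw [abs_le] at *
  constructor <;> linarith [h1.1, h1.2, h2.1, h2.2]

/-- Dropping the height of P + R would leave the factor 2, too weak for -2.75. Applying the law to P
+ R and R bounds that height below by about half the height of P, which improves the factor to 3/2.
-/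
lemma scaledHeight_sub_le (hC : ParallelogramBound A B D C) (P R : Pt A B D ℚ) :
    scaledHeight (P - R) ≤ 3 / 2 * scaledHeight P + 3 * scaledHeight R + 3 / 2 * C := by
  have h1 := (abs_le.mp (hC P R)).2
  have h2 := (abs_le.mp (hC (P + R) R)).2
  rw [add_sub_cancel_right] at h2
  linarith [scaledHeight_nonneg (P + R + R)]

lemma le_scaledHeight_sub (hC : ParallelogramBound A B D C) (P R : Pt A B D ℚ) :
    1 / 2 * scaledHeight P - scaledHeight R - 1 / 2 * C ≤ scaledHeight (P - R) := by
  have h2 := (abs_le.mp (hC (P - R) R)).2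
  rw [sub_add_cancel] at h2
  linarith [scaledHeight_nonneg (P - R - R)]

end HeightInequalities

end

/-! ### Combining the heights and the distance -/

section

open Height NumberField WeierstrassCurve WeierstrassCurve.Affine WeierstrassCurve.Affine.Point

variable {A B : ℤ} {D : ℕ}

lemma three_nsmul_eq_or_of_map {G H : Type*} [AddCommGroup G] [AddCommGroup H] {f : G →+ H}
    (hf : Function.Injective f) {q r : G} {s : H} (hs : s = f q ∨ s = -f q) (h : 3 • s = f r) :
    3 • q = r ∨ 3 • q = -r := by
  rcases hs with rfl | rfl
  · left
    apply hf
    rw [map_nsmul, h]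
  · right
    apply hf
    rw [map_nsmul, map_neg, ← h, smul_neg, neg_neg]

lemma xDist_ne_zero (ι : Qbar →+* ℂ) {P Q R : Pt A B D ℚ} (h : P = 3 • Q + R) (hP : P ≠ 0)
    (hPR : P ≠ R + R) (hQ : Q ≠ 0) (hR : R ≠ 0) {S : Pt A B D Qbar} (hS : S ∈ third R) :
    xDist ι Q S ≠ 0 := by
  classical
  intro h0
  rcases Q with _ | ⟨q, q', hq⟩
  · exact hQ rfl
  rcases S with _ | ⟨x, y, hx⟩
  · have h1 : 3 • (Point.zero : Pt A B D Qbar) = 0 := smul_zero 3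
    exact hR (Point.map_injective _ ((h1.symm.trans hS).symm.trans (Point.map_zero _).symm))
  · rw [xDist, norm_eq_zero, sub_eq_zero] at h0
    change (q : ℂ) = ι x at h0
    rw [← map_ratCast ι q] at h0
    obtain ⟨hq1, hq2⟩ := baseChange_some hq
    have h1 := (X_eq_iff (h₁ := hx) (h₂ := hq1)).mp (ι.injective h0).symm
    have h1' : Point.some x y hx = WeierstrassCurve.Affine.Point.baseChange (W' := twist A B D)
        ℚ Qbar (Point.some q q' hq) ∨ Point.some x y hx =
        -WeierstrassCurve.Affine.Point.baseChange (W' := twist A B D) ℚ Qbar (Point.some q q' hq) :=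
      h1.imp (·.trans hq2.symm) (·.trans (congrArg Neg.neg hq2.symm))
    rcases three_nsmul_eq_or_of_map (Point.map_injective _) h1' hS with h2 | h2
    · exact hPR (by rw [h, h2])
    · exact hP (by rw [h, h2, neg_add_cancel])

/-- The height estimates for `P = 3 Q + R`, `3 S = R`. -/
lemma height_estimates {C₁ C₂ : ℝ} (hD : 3 ≤ D) (hC₁ : ParallelogramBound A B D C₁)
    (hC₂ : ∀ R : Pt A B D ℚ, R ≠ 0 → ∀ S ∈ third R,
      height S ≤ height R + 2 * Real.log (D + 1) + C₂)
    (hD₁ : C₁ ≤ Real.log D) (hD₂ : C₂ ≤ Real.log D) {P Q R : Pt A B D ℚ} (h : P = 3 • Q + R)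
    (hR : R ≠ 0) (hPR : height P > 1000 * height R) (hPD : height P > 2000 * Real.log D)
    {S : Pt A B D Qbar} (hS : S ∈ third R) :
    height Q > 5.77 * height S ∧ 0 < height Q ∧ 2.75 * height Q ≤ 0.4625 * height P ∧
      P ≠ R + R := by
  have hD0 : D ≠ 0 := by omega
  have hDR : (3 : ℝ) ≤ D := by exact_mod_cast hD
  have hlog : 0 < Real.log D := Real.log_pos (by linarith)
  have hlog1 : Real.log (D + 1) ≤ 2 * Real.log D := by
    rw [← Real.log_rpow (by linarith)]
    refine Real.log_le_log (by linarith) ?_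
    norm_num
    nlinarith
  have e := fun P ↦ abs_le.mp (abs_scaledHeight_sub_height_le hD0 (A := A) (B := B) P)
  have hS' := hC₂ R hR S hS
  have h3 := abs_le.mp (abs_scaledHeight_three_nsmul_sub_le hC₁ Q)
  have hle := scaledHeight_sub_le hC₁ P R
  have hge := le_scaledHeight_sub hC₁ P R
  rw [← eq_sub_of_add_eq h.symm] at hle hge
  have eP := e P
  have eQ := e Q
  have eR := e R
  have hR0 := height_nonneg R
  refine ⟨?_, ?_, ?_, ?_⟩
  -- All errors are multiples of log D < h(P)/2000. They leave h(Q) > 0.054 h(P) against h(S) <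
  -- 0.0036 h(P), and h(Q) ≤ 0.168 h(P), whence 0.4625 below.
  · linarith [h3.1, h3.2, eP.1, eP.2, eQ.1, eQ.2, eR.1, eR.2]
  · linarith [h3.1, h3.2, eP.1, eP.2, eQ.1, eQ.2, eR.1, eR.2]
  · linarith [h3.1, h3.2, eP.1, eP.2, eQ.1, eQ.2, eR.1, eR.2]
  · intro h2
    have h4 := abs_le.mp (abs_scaledHeight_two_nsmul_sub_le hC₁ R)
    rw [← h2] at h4
    linarith [h4.2, eP.1, eR.2]

/-- The archimedean estimate: some third of `R` has `x`-coordinate close to `x(Q)`. -/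
lemma exists_third_xDist_le (hE : 4 * A ^ 3 + 27 * B ^ 2 ≠ 0) (hD : 3 ≤ D) (hA : |A| ≤ D)
    (hB : |B| ≤ D) (ι : Qbar →+* ℂ) {P Q R : Pt A B D ℚ} (hP : IsIntegralPoint P)
    (h : P = 3 • Q + R) (hQ : Q ≠ 0) (hR : R ≠ 0) (hPR : height P > 1000 * height R)
    (hPD : height P > 2000 * Real.log D) :
    ∃ T ∈ third R, xDist ι Q T ≤ Real.exp (-0.488 * height P) := by
  have hD0 : D ≠ 0 := by omega
  have hDR : (3 : ℝ) ≤ D := by exact_mod_cast hD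
  have hlog : 1 < Real.log D := by
    rw [Real.lt_log_iff_exp_lt (by linarith)]
    exact Real.exp_one_lt_d9.trans (by linarith)
  obtain ⟨p, p', hp, rfl⟩ := hP
  rcases Q with _ | ⟨q, q', hq⟩
  · exact absurd rfl hQ
  rcases R with _ | ⟨r, r', hr⟩
  · exact absurd rfl hR
  set H := height (Point.some (p : ℚ) (p' : ℚ) hp : Pt A B D ℚ) with hH
  set m := Real.exp (H / 1000) with hm
  have hmD : (D : ℝ) ^ 2 ≤ m := by
    rw [hm, ← Real.log_le_iff_le_exp (by positivity), Real.log_pow]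
    push_cast
    linarith
  have hm9 : 9 ≤ m := by nlinarith
  have hmD4 : (D : ℝ) ^ 4 ≤ m ^ 2 := by
    rw [show (D : ℝ) ^ 4 = (D ^ 2) ^ 2 by ring]
    gcongr
  have habs {n : ℤ} (hn : |n| ≤ D) : ‖(n : ℂ)‖ ≤ D := by
    rw [Complex.norm_intCast]
    exact_mod_cast hn
  have ha : ‖(D : ℂ) ^ 2 * A‖ ≤ m ^ 2 := by
    rw [norm_mul, norm_pow, Complex.norm_natCast]
    calc (D : ℝ) ^ 2 * ‖(A : ℂ)‖ ≤ (D : ℝ) ^ 2 * D := by gcongr; exact habs hA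
      _ ≤ (D : ℝ) ^ 4 := by nlinarith [pow_pos (by linarith : (0 : ℝ) < D) 3]
      _ ≤ _ := hmD4
  have hb : ‖(D : ℂ) ^ 3 * B‖ ≤ m ^ 2 := by
    rw [norm_mul, norm_pow, Complex.norm_natCast]
    calc (D : ℝ) ^ 3 * ‖(B : ℂ)‖ ≤ (D : ℝ) ^ 3 * D := by gcongr; exact habs hB
      _ = (D : ℝ) ^ 4 := by ring
      _ ≤ _ := hmD4
  have hrm : ‖(r : ℂ)‖ ≤ m := by
    rw [Complex.norm_ratCast]
    refine (abs_le_exp_height hr).trans (Real.exp_le_exp.mpr ?_)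
    linarith
  have hpH : ‖((p : ℚ) : ℂ)‖ = Real.exp H := by
    rw [Rat.cast_intCast, Complex.norm_intCast]
    exact abs_eq_exp_height hp (by linarith)
  have hlarge : Real.log 560000 ≤ 14 := by
    rw [Real.log_le_iff_le_exp (by norm_num), show (14 : ℝ) = (14 : ℕ) * 1 by norm_num,
      Real.exp_nat_mul]
    calc (560000 : ℝ) ≤ 2.7 ^ 14 := by norm_num
      _ ≤ _ := by gcongr; exact (by norm_num : (2.7 : ℝ) ≤ 2.7182818283).trans
                    Real.exp_one_gt_d9.le
  have hm2 : m ^ 2 = Real.exp (H / 500) := by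
    rw [hm, ← Real.exp_nat_mul]
    congr 1
    push_cast
    ring
  have hc : (560000 : ℝ) ≤ Real.exp (H / 100) := by
    rw [← Real.log_le_iff_le_exp (by norm_num)]
    linarith
  have hbig : (100000 * m ^ 2) ^ 2 ≤ ‖((p : ℚ) : ℂ)‖ := by
    rw [hpH, hm2]
    calc (100000 * Real.exp (H / 500)) ^ 2
        ≤ (Real.exp (H / 100) * Real.exp (H / 500)) ^ 2 := by gcongr; linarith
      _ = Real.exp (H / 50 + H / 250) := by
          rw [← Real.exp_add, ← Real.exp_nat_mul]
          congr 1
          push_cast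
          ring
      _ ≤ Real.exp H := Real.exp_le_exp.mpr (by linarith)
  obtain ⟨T, hT, hle⟩ := exists_close_third hE hD0 ι (by linarith) ha hb h hrm hbig
  refine ⟨T, hT, hle.trans ?_⟩
  rw [hpH, ← Real.exp_half, hm2, div_le_iff₀ (Real.exp_pos _), ← Real.exp_add]
  -- The exponent is 1/100 + 1/500 - 1/2 = -0.488.
  calc 560000 * Real.exp (H / 500) ≤ Real.exp (H / 100) * Real.exp (H / 500) := by gcongr
    _ = Real.exp (-0.488 * H + H / 2) := by
        rw [← Real.exp_add]
        congr 1
        ring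

end

end QuadraticTwist

end

open QuadraticTwist in
theorem lemma8p2 (A B : ℤ) (hE : 4 * A ^ 3 + 27 * B ^ 2 ≠ 0) :
    ∃ D₀ : ℕ, ∀ D : ℕ, Squarefree D → D₀ ≤ D →
      ∀ M : ℕ, 0 < M → max (10 * √|(A : ℝ)|) (5 * |(B : ℝ)| ^ (1 / 3 : ℝ)) ≤ (M : ℝ) →
      ∀ ι : Qbar →+* ℂ,
      ∀ P Q R : Pt A B D ℚ, IsIntegralPoint P → P = 3 • Q + R →
        (M : ℚ) * (D : ℚ) ≤ xCoord R →
        height P > 1000 * height R →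
        height P > 2000 * Real.log D →
      ∀ S ∈ third R, (∀ T ∈ third R, xDist ι Q S ≤ xDist ι Q T) →
        height Q > 5.77 * height S ∧
        Real.log (xDist ι Q S) / height Q < -2.75 := by
  obtain ⟨C₁, hC₁⟩ := exists_parallelogram hE
  obtain ⟨C₂, hC₂⟩ := exists_height_third_le A B
  obtain ⟨N, hN⟩ := exists_nat_ge (Real.exp (max C₁ C₂))
  -- From this bound on, log D dominates `C₁` and `C₂`, and D dominates |A| and |B|.
  refine ⟨max (max 3 N) (max A.natAbs B.natAbs), fun D _ hD M hM _ ι P Q R hP h hxR hPR hPD S hS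
    hmin ↦ ?_⟩
  simp only [max_le_iff] at hD
  obtain ⟨⟨hD3, hDN⟩, hDA, hDB⟩ := hD
  have hD0 : D ≠ 0 := by omega
  have hDlog : max C₁ C₂ ≤ Real.log D := by
    rw [Real.le_log_iff_exp_le (by positivity)]
    exact hN.trans (by exact_mod_cast hDN)
  have hlog : 0 ≤ Real.log D := Real.log_natCast_nonneg D
  -- The dummy x-coordinate 0 of O is already below M D.
  have hR : R ≠ 0 := by
    rintro rfl
    have h1 : (0 : ℚ) < M * D := by positivity
    exact absurd hxR (not_le.mpr h1)
  have hQ : Q ≠ 0 := by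
    rintro rfl
    rw [smul_zero, zero_add] at h
    subst h
    linarith
  have hP0 : P ≠ 0 := by
    obtain ⟨x, y, hxy, rfl⟩ := hP
    exact WeierstrassCurve.Affine.Point.some_ne_zero hxy
  obtain ⟨h1, h2, h3, h4⟩ := height_estimates hD3 (hC₁ D hD0) (hC₂ D hD0)
    ((le_max_left _ _).trans hDlog) ((le_max_right _ _).trans hDlog) h hR hPR hPD hS
  refine ⟨h1, ?_⟩
  obtain ⟨T, hT, hle⟩ := exists_third_xDist_le hE hD3 (by rw [Int.abs_eq_natAbs]; omega)
    (by rw [Int.abs_eq_natAbs]; omega) ι hP h hQ hR hPR hPD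
  have h5 : 0 < xDist ι Q S :=
    lt_of_le_of_ne (norm_nonneg _) (xDist_ne_zero ι h hP0 h4 hQ hR hS).symm
  have h6 : Real.log (xDist ι Q S) ≤ -0.488 * height P := by
    rw [Real.log_le_iff_le_exp h5]
    exact (hmin T hT).trans hle
  rw [div_lt_iff₀ h2]
  linarith
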